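/- Let $K$ be an infinite field, $n\ge 0$, and let $X$ be a non-empty finite set of $s\le 2n$ distinct ($K$-rational) points of the projective space $\mathbf P^n=\mathbf P^n_K$ in general linear position, i.e. any $k\le n+1$ of the points of $X$ are linearly independent. Let $R=R(X)=K[x_0,\dots,x_n]/I(X)$ be the coordinate ring of $X$, where $I(X)$ is the ideal generated by the homogeneous polynomials vanishing at all points of $X$, with its standard grading $R=\bigoplus_{i\ge 0}R_i$. Then: (1) $R$ has a Gröbner flag: there is a complete flag of subspaces $0=V_0\subset V_1\subset\dots\subset V_d=R_1$, $\dim_K V_i=i$, such that the family of ideals $F=\{(V_0),(V_1),\dots,(V_d)\}$ of $R$ is a Koszul filtration. Here a family $F$ of ideals of $R$ is a Koszul filtration if every ideal in $F$ is generated by linear forms (elements of $R_1$), the ideals $(0)$ and $\bigoplus_{i>0}R_i$ belong to $F$, and for every non-zero $I\in F$ there is $J\in F$ such that $J\subset I$, $I/J$ is cyclic and $J:I\in F$. (2) In particular, $R$ is G-quadratic: for some basis $b_1,\dots,b_d$ of $R_1$ and some term order on $K[y_1,\dots,y_d]$, the kernel of the surjective $K$-algebra homomorphism $K[y_1,\dots,y_d]\to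 R$, $y_i\mapsto b_i$, has a Gröbner basis consisting of quadrics (homogeneous polynomials of degree $2$). -/

import Mathlib

namespace PointsGroebner

open MvPolynomial

section GradedAlgebras

variable {K R : Type*} [Field K] [CommRing R] [Algebra K R]

/-- A family `F` of ideals of the graded `K`-algebra `R` (with homogeneous components `𝒜 i`) is a
Koszul filtration. -/
structure IsKoszulFiltration (𝒜 : ℕ → Submodule K R) (F : Set (Ideal R)) : Prop where
  /-- every ideal in `F` is generated by linear forms -/
  linear : ∀ I ∈ F, ∃ S : Set R, S ⊆ (𝒜 1 : Set R) ∧ I = Ideal.span S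
  bot_mem : ⊥ ∈ F
  /-- the maximal homogeneous ideal, generated by all components of positive degree, is in `F` -/
  max_mem : Ideal.span {x : R | ∃ i, 0 < i ∧ x ∈ 𝒜 i} ∈ F
  /-- every nonzero `I ∈ F` contains some `J ∈ F` such that `I / J` is cyclic (that is,
  `I = J + (x)` for some `x`) and `J : I` is in `F` -/
  step : ∀ I ∈ F, I ≠ ⊥ →
    ∃ J ∈ F, J ≤ I ∧ (∃ x : R, I = J ⊔ Ideal.span {x}) ∧ J.colon (I : Set R) ∈ F

/-- A Gröbner flag of `R`: a Koszul filtration `{(V 0), (V 1), …, (V d)}` that consists of the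
ideals generated by the members of one complete flag `V 0 ⊆ V 1 ⊆ ⋯ ⊆ V d = 𝒜 1`,
`dim (V i) = i`, of linear subspaces of the degree one component. -/
def IsGroebnerFlag (𝒜 : ℕ → Submodule K R) (F : Set (Ideal R)) : Prop :=
  IsKoszulFiltration 𝒜 F ∧
  ∃ (d : ℕ) (V : Fin (d + 1) → Submodule K R),
    Monotone V ∧
    (∀ i, Module.Finite K (V i) ∧ Module.finrank K (V i) = (i : ℕ)) ∧
    V (Fin.last d) = 𝒜 1 ∧
    F = Set.range fun i => Ideal.span (V i : Set R)

/-- `R` has a Gröbner flag. -/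
def HasGroebnerFlag (𝒜 : ℕ → Submodule K R) : Prop :=
  ∃ F : Set (Ideal R), IsGroebnerFlag 𝒜 F

/-- The finite set `G` is a Gröbner basis of the ideal `I` with respect to the term order `m`:
it lies in `I` and its leading terms generate the initial ideal of `I`. -/
def IsGroebnerBasis {σ : Type*} (m : MonomialOrder σ) (G : Finset (MvPolynomial σ K))
    (I : Ideal (MvPolynomial σ K)) : Prop :=
  (G : Set (MvPolynomial σ K)) ⊆ I ∧
  Ideal.span (m.leadingTerm '' (I : Set (MvPolynomial σ K))) =
    Ideal.span (m.leadingTerm '' (G : Set (MvPolynomial σ K)))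

/-- `R` is G-quadratic: for some system of coordinates, that is a basis `b` of the degree one
component, giving the presentation `K[x_1, …, x_d] → R`, `x_i ↦ b i`, and for some term order,
the defining ideal (the kernel) has a Gröbner basis of quadrics. -/
def IsGQuadratic (𝒜 : ℕ → Submodule K R) : Prop :=
  ∃ (d : ℕ) (b : Module.Basis (Fin d) K (𝒜 1)),
    Function.Surjective (aeval (R := K) fun i => (b i : R)) ∧
    ∃ (m : MonomialOrder.{0, 0} (Fin d)) (G : Finset (MvPolynomial (Fin d) K)),
      IsGroebnerBasis m G (RingHom.ker (aeval (R := K) fun i => (b i : R))) ∧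
      ∀ g ∈ G, g.IsHomogeneous 2

end GradedAlgebras

section Points

variable {K : Type*} [Field K] {n : ℕ}

/-- A finite set of points of `ℙⁿ` is in general linear position: any `k ≤ n + 1` of the points
are linearly independent. -/
def InGeneralLinearPosition (X : Finset (Projectivization K (Fin (n + 1) → K))) : Prop :=
  ∀ Y ⊆ X, Y.card ≤ n + 1 →
    Projectivization.Independent
      (fun p : Y => (p : Projectivization K (Fin (n + 1) → K)))

/-- The homogeneous ideal `I(X)` of `X`, generated by the homogeneous polynomials that vanish at
(all representatives of) all points of `X`. -/
noncomputable def vanishingIdeal (X : Finset (Projectivization K (Fin (n + 1) → K))) :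
    Ideal (MvPolynomial (Fin (n + 1)) K) :=
  Ideal.span {f | (∃ d, f.IsHomogeneous d) ∧
    ∀ (v : Fin (n + 1) → K) (hv : v ≠ 0), Projectivization.mk K v hv ∈ X → eval v f = 0}

/-- The homogeneous coordinate ring `R(X) = K[x_0, …, x_n] / I(X)`. -/
abbrev CoordinateRing (X : Finset (Projectivization K (Fin (n + 1) → K))) : Type _ :=
  MvPolynomial (Fin (n + 1)) K ⧸ vanishingIdeal X

/-- The grading of `R(X)`: the component `R(X)_d` is the image of the forms of degree `d`. -/
noncomputable def coordinateGrading (X : Finset (Projectivization K (Fin (n + 1) → K))) (d : ℕ) :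
    Submodule K (CoordinateRing X) :=
  (homogeneousSubmodule (Fin (n + 1)) K d).map
    (Ideal.Quotient.mkₐ K (vanishingIdeal X)).toLinearMap

end Points

end PointsGroebner

/-! Split `X` into two halves `A` and `B` of at most `n` points each; this is where `s ≤ 2n` enters.
General position over an infinite field gives linear forms `m` and `m'` whose zero sets in `X` are
exactly `B` and `A`. Put `l = m + m'`. Homogeneous elements of `R` are determined by their values at
the points, so three facts can be checked pointwise: `l` vanishes nowhere and is a nonzerodivisor;
`m² = l m`; and `R_2 = l R_1 + m R_1`, because linear forms take arbitrary values on each half. A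
single point is handled apart, with `R_1` spanned by `l`.

Let `U` be the space of linear forms `x` with `m x ∈ l R_1`. It contains `l` and `m`, so the flag
can be chosen to refine `0 ⊂ ⟨l⟩ ⊂ ⟨l, m⟩ ⊆ U ⊆ R_1`. Its successive colon ideals are `0 : (l) = 0`,
`(l) : (l, m) = (U)`, and from then on the maximal ideal, since `R_2 ⊆ (l, m)`. `AdaptedSequence`
records such a basis, and both conclusions follow from it alone.

For the Gröbner basis, the same facts rewrite `x_1 x_j` with `j < u` into multiples of `x_0`, and
`x_i x_j` with `i, j ≥ 2` into the ideal `(x_0, x_1)`. A weight order makes these products leading,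
and `eq_zero_of_standard` shows that the remaining monomials are independent in `R`. -/

namespace PointsGroebner

open MvPolynomial

/-! ### Flags spanned by initial segments of a sequence -/

section InitialSpan

variable {K E : Type*} [Field K] [AddCommGroup E] [Module K E]

variable (K) in
/-- The span of the first `k` members of a sequence. -/
def initialSpan (v : ℕ → E) (k : ℕ) : Submodule K E :=
  Submodule.span K (Set.range fun i : Fin k => v i)

lemma mem_initialSpan {v : ℕ → E} {i k : ℕ} (h : i < k) : v i ∈ initialSpan K v k :=
  Submodule.subset_span ⟨⟨i, h⟩, rfl⟩

lemma initialSpan_le {v : ℕ → E} {k : ℕ} {W : Submodule K E} :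
    initialSpan K v k ≤ W ↔ ∀ i < k, v i ∈ W := by
  rw [initialSpan, Submodule.span_le, Set.range_subset_iff]
  exact ⟨fun h i hi => h ⟨i, hi⟩, fun h i => h i i.2⟩

lemma initialSpan_mono (v : ℕ → E) : Monotone (initialSpan K v) := fun _ _ hkl =>
  initialSpan_le.2 fun _ hi => mem_initialSpan (hi.trans_le hkl)

lemma initialSpan_zero (v : ℕ → E) : initialSpan K v 0 = ⊥ := by
  simp [initialSpan]

lemma initialSpan_congr {v w : ℕ → E} {k : ℕ} (h : ∀ i < k, v i = w i) :
    initialSpan K v k = initialSpan K w k := by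
  have : (fun i : Fin k => v i) = fun i : Fin k => w i := funext fun i => h i i.2
  rw [initialSpan, initialSpan, this]

lemma linearIndependent_initial_succ {v : ℕ → E} {k : ℕ} :
    LinearIndependent K (fun i : Fin (k + 1) => v i) ↔
      LinearIndependent K (fun i : Fin k => v i) ∧ v k ∉ initialSpan K v k := by
  rw [linearIndependent_finSucc']
  rfl

lemma linearIndependent_initial_mono {v : ℕ → E} {k l : ℕ} (hkl : k ≤ l)
    (h : LinearIndependent K (fun i : Fin l => v i)) :
    LinearIndependent K (fun i : Fin k => v i) :=
  h.comp (Fin.castLE hkl) (Fin.castLE_injective hkl)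

lemma notMem_initialSpan {v : ℕ → E} {k l : ℕ} (hkl : k < l)
    (h : LinearIndependent K (fun i : Fin l => v i)) : v k ∉ initialSpan K v k :=
  (linearIndependent_initial_succ.1 (linearIndependent_initial_mono hkl h)).2

lemma finrank_initialSpan {v : ℕ → E} {k : ℕ}
    (h : LinearIndependent K (fun i : Fin k => v i)) :
    Module.finrank K (initialSpan K v k) = k := by
  rw [initialSpan, finrank_span_eq_card h, Fintype.card_fin]

instance (v : ℕ → E) (k : ℕ) : Module.Finite K (initialSpan K v k) :=
  Module.Finite.span_of_finite K (Set.finite_range _)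

/-- A linearly independent sequence in a finite-dimensional subspace extends to a basis. -/
lemma exists_extend_initial (W : Submodule K E) [Module.Finite K W] (v : ℕ → E) (k : ℕ)
    (hli : LinearIndependent K (fun i : Fin k => v i)) (hv : ∀ i < k, v i ∈ W) :
    ∃ (d : ℕ) (w : ℕ → E), k ≤ d ∧ (∀ i < k, w i = v i) ∧
      LinearIndependent K (fun i : Fin d => w i) ∧ initialSpan K w d = W := by
  induction hr : Module.finrank K W - k generalizing v k with
  | zero =>
    refine ⟨k, v, le_rfl, fun _ _ => rfl, hli, ?_⟩
    apply Submodule.eq_of_le_of_finrank_le (initialSpan_le.2 hv)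
    rw [finrank_initialSpan hli]
    omega
  | succ r ih =>
    have hlt : initialSpan K v k < W := by
      refine lt_of_le_of_ne (initialSpan_le.2 hv) fun h => ?_
      have := finrank_initialSpan hli
      rw [h] at this
      omega
    obtain ⟨x, hxW, hx⟩ := SetLike.exists_of_lt hlt
    have hne : ∀ i < k, Function.update v k x i = v i := fun i hi =>
      Function.update_of_ne hi.ne _ _
    obtain ⟨d, w, hd, hw, h1, h2⟩ := ih (Function.update v k x) (k + 1)
      (by
        rw [linearIndependent_initial_succ, initialSpan_congr hne, Function.update_self]
        refine ⟨?_, hx⟩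
        convert hli using 2 with i
        exact hne i i.2)
      (fun i hi => by
        rcases Nat.lt_succ_iff_lt_or_eq.1 hi with h | rfl
        · rw [hne i h]; exact hv i h
        · rwa [Function.update_self])
      (by omega)
    exact ⟨d, w, by omega, fun i hi => (hw i (by omega)).trans (hne i hi), h1, h2⟩

end InitialSpan

/-! ### Adapted sequences and the Gröbner flag -/

section Graded

variable {K R : Type*} [Field K] [CommRing R] [Algebra K R] (𝒜 : ℕ → Submodule K R)

/-- The first `d` members of `v` form a basis of `𝒜 1` in which `v 0` is a nonzerodivisor,
`𝒜 2 = v 0 * 𝒜 1 + v 1 * 𝒜 1`, and the first `u` members, among them `v 0` and `v 1`, span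
the space of all linear forms `x` with `v 1 * x ∈ v 0 * 𝒜 1`. -/
structure AdaptedSequence (d u : ℕ) (v : ℕ → R) : Prop where
  one_le : 1 ≤ u
  le : u ≤ d
  two_le : 2 ≤ d → 2 ≤ u
  li : LinearIndependent K (fun i : Fin d => v i)
  span_eq : initialSpan K v d = 𝒜 1
  regular : ∀ x, v 0 * x = 0 → x = 0
  mem_iff : 2 ≤ d → ∀ x ∈ 𝒜 1, x ∈ initialSpan K v u ↔ ∃ y ∈ 𝒜 1, v 1 * x = v 0 * y
  exists_eq : 2 ≤ d → ∀ x ∈ 𝒜 2, ∃ y ∈ 𝒜 1, ∃ z ∈ 𝒜 1, x = v 0 * y + v 1 * z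

variable {𝒜}

/-- This covers a single point. With `d = 1` the conditions that involve `v 1` are vacuous. -/
lemma exists_adaptedSequence_of_le_span [Nontrivial R] {l : R} (hl : l ∈ 𝒜 1)
    (hreg : ∀ x, l * x = 0 → x = 0) (h : 𝒜 1 ≤ K ∙ l) :
    ∃ v, AdaptedSequence 𝒜 1 1 v := by
  have hl0 : l ≠ 0 := fun h0 => one_ne_zero (hreg 1 (by simp [h0]))
  refine ⟨fun _ => l, le_rfl, le_rfl, by simp, ?_, ?_, hreg, by simp, by simp⟩
  · exact linearIndependent_unique_iff.2 hl0
  · refine le_antisymm (initialSpan_le.2 fun _ _ => hl) (h.trans ?_)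
    rw [Submodule.span_singleton_le_iff_mem]
    exact mem_initialSpan (v := fun _ => l) one_pos

/-- The space `U` of linear forms `x` with `m x ∈ l R_1` contains `l` trivially and `m` by `hsq`.
Extending `l, m` first to a basis of `U` and only then to one of `R_1` makes `U` itself a member of
the flag. -/
lemma exists_adaptedSequence [Module.Finite K (𝒜 1)] {l m : R} (hl : l ∈ 𝒜 1) (hm : m ∈ 𝒜 1)
    (hlm : LinearIndependent K ![l, m]) (hreg : ∀ x, l * x = 0 → x = 0)
    (hsq : ∃ y ∈ 𝒜 1, m * m = l * y)
    (htwo : ∀ x ∈ 𝒜 2, ∃ y ∈ 𝒜 1, ∃ z ∈ 𝒜 1, x = l * y + m * z) :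
    ∃ d u v, AdaptedSequence 𝒜 d u v := by
  let U : Submodule K R := 𝒜 1 ⊓ ((𝒜 1).map (LinearMap.mulLeft K l)).comap (LinearMap.mulLeft K m)
  have hU : ∀ x, x ∈ U ↔ x ∈ 𝒜 1 ∧ ∃ y ∈ 𝒜 1, m * x = l * y := fun x => by
    simp [U, eq_comm]
  have : Module.Finite K U := Submodule.finiteDimensional_of_le (inf_le_left : U ≤ 𝒜 1)
  have key : (fun i : Fin 2 => (fun j : ℕ => if j = 0 then l else m) i) = ![l, m] := by
    ext i; fin_cases i <;> rfl
  obtain ⟨u, w, hu, hw, hwli, hwU⟩ := exists_extend_initial U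
    (fun j => if j = 0 then l else m) 2 (by rw [key]; exact hlm) (fun i hi => by
      rw [hU]
      interval_cases i
      · exact ⟨hl, m, hm, mul_comm _ _⟩
      · exact ⟨hm, hsq⟩)
  obtain ⟨d, v, hd, hv, hli, hspan⟩ := exists_extend_initial (𝒜 1) w u hwli fun i hi =>
    ((hU _).1 (hwU ▸ mem_initialSpan hi)).1
  have h0 : v 0 = l := by rw [hv 0 (by omega), hw 0 (by omega)]; rfl
  have h1 : v 1 = m := by rw [hv 1 (by omega), hw 1 (by omega)]; rfl
  refine ⟨d, u, v, by omega, hd, fun _ => hu, hli, hspan, by rwa [h0], fun _ x hx => ?_,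
    fun _ => by rwa [h0, h1]⟩
  rw [initialSpan_congr hv, hwU, hU, h0, h1]
  exact and_iff_right hx

lemma mem_span_of_pos (hgen : ∀ i, 𝒜 i = 𝒜 1 ^ i) {i : ℕ} (hi : 0 < i) {x : R} (hx : x ∈ 𝒜 i) :
    x ∈ Ideal.span (𝒜 1 : Set R) := by
  obtain ⟨i, rfl⟩ := Nat.exists_eq_add_of_lt hi
  rw [zero_add, hgen, pow_succ] at hx
  induction hx using Submodule.mul_induction_on' with
  | mem_mul_mem a _ b hb => exact Ideal.mul_mem_left _ _ (Ideal.subset_span hb)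
  | add a _ b _ ha hb => exact add_mem ha hb

namespace AdaptedSequence

variable {d u : ℕ} {v : ℕ → R}

lemma initialSpan_le_one (h : AdaptedSequence 𝒜 d u v) {k : ℕ} (hk : k ≤ d) :
    initialSpan K v k ≤ 𝒜 1 :=
  (initialSpan_mono v hk).trans h.span_eq.le

lemma mem_one (h : AdaptedSequence 𝒜 d u v) {k : ℕ} (hk : k < d) : v k ∈ 𝒜 1 :=
  h.initialSpan_le_one hk (mem_initialSpan k.lt_succ_self)

/-- `R_{i+2} = R_i R_2`, and `R_2` already lies in `(v 0, v 1)`. -/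
lemma mem_span_two (hgen : ∀ i, 𝒜 i = 𝒜 1 ^ i) (h : AdaptedSequence 𝒜 d u v) (hd : 2 ≤ d)
    {k : ℕ} (hk : 2 ≤ k) {i : ℕ} {x : R} (hx : x ∈ 𝒜 (i + 2)) :
    x ∈ Ideal.span (initialSpan K v k : Set R) := by
  rw [hgen, pow_add, ← hgen, ← hgen] at hx
  induction hx using Submodule.mul_induction_on' with
  | mem_mul_mem a _ b hb =>
    obtain ⟨y, _, z, _, rfl⟩ := h.exists_eq hd b hb
    refine Ideal.mul_mem_left _ _ (add_mem ?_ ?_) <;>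
    exact Ideal.mul_mem_right _ _ (Ideal.subset_span (mem_initialSpan (by omega)))
  | add a _ b _ ha hb => exact add_mem ha hb

end AdaptedSequence

section Components

variable [GradedAlgebra 𝒜]

open DirectSum

lemma mem_of_forall_decompose_mem {I : Ideal R} {x : R}
    (h : ∀ i, (decompose 𝒜 x i : R) ∈ I) : x ∈ I := by
  classical
  rw [← sum_support_decompose 𝒜 x]
  exact sum_mem fun i _ => h i

lemma decompose_succ_mul {x y : R} (hy : y ∈ 𝒜 1) (i : ℕ) :
    (decompose 𝒜 (x * y) (i + 1) : R) = decompose 𝒜 x i * y :=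
  coe_decompose_mul_add_of_right_mem 𝒜 hy

lemma exists_decompose_zero_eq (hgen : ∀ i, 𝒜 i = 𝒜 1 ^ i) (x : R) :
    ∃ c : K, (decompose 𝒜 x 0 : R) = algebraMap K R c := by
  have h : (decompose 𝒜 x 0 : R) ∈ 𝒜 1 ^ 0 := hgen 0 ▸ (decompose 𝒜 x 0).2
  rw [pow_zero, Submodule.mem_one] at h
  exact h.imp fun _ => Eq.symm

/-- The degree one part of `r w`, for `w` linear, is `w` times the scalar `r_0`; hence the ideal
`(W)` contains no linear forms beyond `W`. -/
lemma decompose_one_mem_of_mem_span (hgen : ∀ i, 𝒜 i = 𝒜 1 ^ i) {W : Submodule K R}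
    (hW : W ≤ 𝒜 1) {x : R} (hx : x ∈ Ideal.span (W : Set R)) :
    (decompose 𝒜 x 1 : R) ∈ W := by
  -- The extra multiplier `r` makes the claim stable under the scalar step of the span induction.
  suffices ∀ r : R, (decompose 𝒜 (r * x) 1 : R) ∈ W by simpa using this 1
  induction hx using Submodule.span_induction with
  | zero => simp
  | add a b _ _ ha hb =>
    intro r
    rw [mul_add, decompose_add, DirectSum.add_apply, Submodule.coe_add]
    exact W.add_mem (ha r) (hb r)
  | mem a ha =>
    intro r
    obtain ⟨c, hc⟩ := exists_decompose_zero_eq hgen r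
    rw [decompose_succ_mul (hW ha) 0, hc, ← Algebra.smul_def]
    exact W.smul_mem c ha
  | smul s a ha ih =>
    intro r
    rw [smul_eq_mul, ← mul_assoc]
    exact ih _

namespace AdaptedSequence

variable {d u : ℕ} {v : ℕ → R}

/-- This computes `(v 0) : (v 0, v 1)` degree by degree. Degree 0 contributes nothing by
independence, degree 1 gives `U` by its definition, and everything of degree at least 2 lies in `(v
0, v 1) ⊆ (U)`. -/
lemma mem_span_iff_of_two_le (hgen : ∀ i, 𝒜 i = 𝒜 1 ^ i) (h : AdaptedSequence 𝒜 d u v)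
    (hd : 2 ≤ d) (x : R) :
    x * v 1 ∈ Ideal.span (initialSpan K v 1 : Set R) ↔
      x ∈ Ideal.span (initialSpan K v u : Set R) := by
  have hu := h.two_le hd
  have hone : Ideal.span (initialSpan K v 1 : Set R) = Ideal.span {v 0} := by
    refine le_antisymm ?_ (Ideal.span_mono (Set.singleton_subset_iff.2 (mem_initialSpan one_pos)))
    rw [Ideal.span_le]
    intro y hy
    rw [SetLike.mem_coe, initialSpan, Set.range_unique, Submodule.mem_span_singleton] at hy
    obtain ⟨c, rfl⟩ := hy
    rw [Algebra.smul_def]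
    exact Ideal.mul_mem_left _ _ (Ideal.mem_span_singleton_self _)
  rw [hone]
  constructor
  · intro hx
    obtain ⟨g, hg⟩ := Ideal.mem_span_singleton'.1 hx
    have hcomp : ∀ i, (decompose 𝒜 x i : R) * v 1 = decompose 𝒜 g i * v 0 := fun i => by
      rw [← decompose_succ_mul (h.mem_one hd), ← hg, decompose_succ_mul (h.mem_one (by omega))]
    refine mem_of_forall_decompose_mem (𝒜 := 𝒜) fun i => ?_
    match i with
    | 0 =>
      obtain ⟨c, hc⟩ := exists_decompose_zero_eq hgen x
      obtain ⟨e, he⟩ := exists_decompose_zero_eq hgen g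
      by_cases hc0 : c = 0
      · rw [hc, hc0, map_zero]
        exact zero_mem _
      -- A nonzero constant `c` would give `c v_1 = e v_0`.
      · refine absurd ?_ (notMem_initialSpan hd h.li)
        have h0 := hcomp 0
        rw [hc, he, ← Algebra.smul_def, ← Algebra.smul_def] at h0
        rw [← Submodule.smul_mem_iff _ hc0, h0]
        exact Submodule.smul_mem _ _ (mem_initialSpan one_pos)
    | 1 =>
      refine Ideal.subset_span ((h.mem_iff hd _ (decompose 𝒜 x 1).2).2
        ⟨decompose 𝒜 g 1, (decompose 𝒜 g 1).2, ?_⟩)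
      rw [mul_comm, hcomp, mul_comm]
    | i + 2 => exact h.mem_span_two hgen hd hu (decompose 𝒜 x (i + 2)).2
  · intro hx
    induction hx using Submodule.span_induction with
    | zero => simp
    | add a b _ _ ha hb => rw [add_mul]; exact add_mem ha hb
    | mem a ha =>
      obtain ⟨y, _, hy⟩ := (h.mem_iff hd a (h.initialSpan_le_one h.le ha)).1 ha
      rw [mul_comm, hy]
      exact Ideal.mul_mem_right _ _ (Ideal.mem_span_singleton_self _)
    | smul r a _ ih => rw [smul_eq_mul, mul_assoc]; exact Ideal.mul_mem_left _ _ ih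

/-- A nonzero constant term of `x` would force `v k` into the span of its predecessors. Conversely
`R_1 v_k ⊆ R_2 ⊆ (v 0, v 1)`, so the colon ideal is maximal. -/
lemma mem_span_iff_of_three_le (hgen : ∀ i, 𝒜 i = 𝒜 1 ^ i) (h : AdaptedSequence 𝒜 d u v)
    {k : ℕ} (hk : 2 ≤ k) (hkd : k < d) (x : R) :
    x * v k ∈ Ideal.span (initialSpan K v k : Set R) ↔
      x ∈ Ideal.span (initialSpan K v d : Set R) := by
  constructor
  · intro hx
    refine mem_of_forall_decompose_mem (𝒜 := 𝒜) fun i => ?_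
    rcases i.eq_zero_or_pos with rfl | hi
    · obtain ⟨c, hc⟩ := exists_decompose_zero_eq hgen x
      have h1 := decompose_one_mem_of_mem_span hgen (h.initialSpan_le_one hkd.le) hx
      rw [decompose_succ_mul (h.mem_one hkd) 0, hc, ← Algebra.smul_def] at h1
      by_cases hc0 : c = 0
      · rw [hc, hc0, map_zero]
        exact zero_mem _
      · exact absurd ((Submodule.smul_mem_iff _ hc0).1 h1) (notMem_initialSpan hkd h.li)
    · rw [h.span_eq]
      exact mem_span_of_pos hgen hi (decompose 𝒜 x i).2
  · intro hx
    induction hx using Submodule.span_induction with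
    | zero => simp
    | add a b _ _ ha hb => rw [add_mul]; exact add_mem ha hb
    | mem a ha =>
      refine h.mem_span_two hgen (by omega) hk (i := 0) ?_
      rw [hgen, zero_add, pow_two]
      exact Submodule.mul_mem_mul (h.initialSpan_le_one le_rfl ha) (h.mem_one hkd)
    | smul r a _ ih => rw [smul_eq_mul, mul_assoc]; exact Ideal.mul_mem_left _ _ ih

theorem hasGroebnerFlag (hgen : ∀ i, 𝒜 i = 𝒜 1 ^ i) (h : AdaptedSequence 𝒜 d u v) :
    HasGroebnerFlag 𝒜 := by
  have hmem : ∀ k ≤ d, Ideal.span (initialSpan K v k : Set R) ∈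
      Set.range fun i : Fin (d + 1) => Ideal.span (initialSpan K v i : Set R) :=
    fun k hk => ⟨⟨k, by omega⟩, rfl⟩
  have hsucc : ∀ k, Ideal.span (initialSpan K v (k + 1) : Set R) =
      Ideal.span (initialSpan K v k : Set R) ⊔ Ideal.span {v k} := by
    intro k
    apply le_antisymm
    · rw [Ideal.span_le]
      refine (initialSpan_le (W := Submodule.restrictScalars K
        (Ideal.span (initialSpan K v k : Set R) ⊔ Ideal.span {v k}))).2 fun i hi => ?_
      rcases Nat.lt_succ_iff_lt_or_eq.1 hi with hi | rfl
      · exact Ideal.mem_sup_left (Ideal.subset_span (mem_initialSpan hi))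
      · exact Ideal.mem_sup_right (Ideal.mem_span_singleton_self _)
    · refine sup_le (Ideal.span_mono (initialSpan_mono v k.le_succ))
        (Ideal.span_mono (Set.singleton_subset_iff.2 (mem_initialSpan k.lt_succ_self)))
  refine ⟨Set.range fun i : Fin (d + 1) => Ideal.span (initialSpan K v i : Set R),
    ⟨?_, ?_, ?_, ?_⟩, d, fun i => initialSpan K v i, ?_, ?_, h.span_eq, rfl⟩
  · rintro _ ⟨i, rfl⟩
    exact ⟨_, h.initialSpan_le_one (Nat.lt_succ_iff.1 i.2), rfl⟩
  · exact ⟨0, by simp [initialSpan_zero]⟩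
  · convert hmem d le_rfl using 1
    rw [h.span_eq]
    apply le_antisymm
    · rw [Ideal.span_le]
      rintro x ⟨i, hi, hx⟩
      exact mem_span_of_pos hgen hi hx
    · exact Ideal.span_mono fun x hx => ⟨1, one_pos, hx⟩
  · rintro _ ⟨⟨k, hk⟩, rfl⟩ hne
    obtain _ | k := k
    · simp [initialSpan_zero] at hne
    have hkd : k < d := by omega
    refine ⟨_, hmem k hkd.le, ?_, ⟨v k, hsucc k⟩, ?_⟩
    · exact Ideal.span_mono (initialSpan_mono v k.le_succ)
    -- The larger ideal is the smaller one plus `(v k)`, so membership in the colon is tested on `v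
    -- k` alone.
    have hcolon : ∀ x, x ∈ (Ideal.span (initialSpan K v k : Set R)).colon
        (Ideal.span (initialSpan K v (k + 1) : Set R) : Set R) ↔
        x * v k ∈ Ideal.span (initialSpan K v k : Set R) := by
      intro x
      rw [Submodule.mem_colon]
      refine ⟨fun hx => hx _ (Ideal.subset_span (mem_initialSpan k.lt_succ_self)),
        fun hx s hs => ?_⟩
      rw [SetLike.mem_coe, hsucc] at hs
      obtain ⟨a, ha, b, hb, rfl⟩ := Submodule.mem_sup.1 hs
      obtain ⟨c, rfl⟩ := Ideal.mem_span_singleton'.1 hb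
      rw [smul_eq_mul, mul_add, mul_left_comm]
      exact add_mem (Ideal.mul_mem_left _ _ ha) (Ideal.mul_mem_left _ _ hx)
    match k with
    | 0 =>
      convert hmem 0 (Nat.zero_le _) using 1
      ext x
      rw [hcolon]
      simp only [initialSpan_zero, Submodule.bot_coe, Ideal.span_singleton_zero, Ideal.mem_bot]
      exact ⟨fun hx => h.regular x (by rwa [mul_comm]), fun hx => by simp [hx]⟩
    | 1 =>
      convert hmem u h.le using 1
      ext x
      rw [hcolon, h.mem_span_iff_of_two_le hgen (by omega)]
    | k + 2 =>
      convert hmem d le_rfl using 1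
      ext x
      rw [hcolon, h.mem_span_iff_of_three_le hgen (by omega) hkd]
  · exact fun i j hij => initialSpan_mono v hij
  · exact fun i => ⟨inferInstance, finrank_initialSpan
      (linearIndependent_initial_mono (Nat.lt_succ_iff.1 i.2) h.li)⟩

end AdaptedSequence

end Components

end Graded

/-! ### Weight orders -/

section WeightOrder

/-- There is a monomial order that compares weights first. -/
lemma exists_monomialOrder_of_weight {σ : Type} [Finite σ] (w : σ → ℕ) :
    ∃ m : MonomialOrder.{0, 0} σ, ∀ a b : σ →₀ ℕ,
      Finsupp.weight w a < Finsupp.weight w b → m.toSyn a < m.toSyn b := by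
  classical
  let _ : LinearOrder σ := linearOrderOfSTO WellOrderingRel
  -- The lexicographic component breaks ties and makes `f` injective, so its range is an ordered
  -- copy of the exponents.
  let f : (σ →₀ ℕ) →+ ℕ ×ₗ Lex (σ →₀ ℕ) :=
    { toFun := fun a => toLex (Finsupp.weight w a, toLex a)
      map_zero' := by simp
      map_add' := fun a b => by simp; rfl }
  have hf : Function.LeftInverse (fun x : ℕ ×ₗ Lex (σ →₀ ℕ) => ofLex (ofLex x).2) f := fun _ => rfl
  let e : (σ →₀ ℕ) ≃+ AddMonoidHom.mrange f := AddEquiv.ofBijective f.mrangeRestrict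
    ⟨fun a b h => hf.injective (congrArg Subtype.val h), f.mrangeRestrict_surjective⟩
  refine ⟨{ syn := AddMonoidHom.mrange f
            toSyn := e
            toSyn_monotone := ?_
            wellFoundedLT_syn := ?_ }, ?_⟩
  · intro a b hab
    rw [← Subtype.coe_le_coe]
    change f a ≤ f b
    rw [Prod.Lex.le_iff']
    refine ⟨?_, fun _ => Finsupp.toLex_monotone hab⟩
    obtain ⟨c, rfl⟩ := exists_add_of_le hab
    simp [f]
  · exact inferInstance
  · intro a b hab
    rw [← Subtype.coe_lt_coe]
    change f a < f b
    exact Prod.Lex.lt_iff.2 (Or.inl hab)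

end WeightOrder

/-! ### A Gröbner basis criterion by standard monomials -/

section Standard

variable {K σ : Type*} [Field K]

/-- A set of polynomials with unit leading coefficients in `I` is a Gröbner basis of `I` if no
nonzero polynomial in `I` is a combination of standard monomials. -/
lemma isGroebnerBasis_of_standard (m : MonomialOrder σ) (G : Finset (MvPolynomial σ K))
    (I : Ideal (MvPolynomial σ K)) (hG : (G : Set (MvPolynomial σ K)) ⊆ I) (h0 : 0 ∉ G)
    (h : ∀ r ∈ I, (∀ c ∈ r.support, ∀ g ∈ G, ¬ m.degree g ≤ c) → r = 0) :
    IsGroebnerBasis m G I := by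
  classical
  refine ⟨hG, le_antisymm ?_ (Ideal.span_mono (Set.image_mono hG))⟩
  rw [Ideal.span_le]
  rintro _ ⟨f, hf, rfl⟩
  by_cases hf0 : f = 0
  · simp [hf0]
  obtain ⟨q, r, hqr, hdeg, hr⟩ := m.div_set (B := (G : Set (MvPolynomial σ K)))
    (fun b hb => by
      rw [isUnit_iff_ne_zero, m.leadingCoeff_ne_zero_iff]
      rintro rfl
      exact h0 hb) f
  have hrI : r ∈ I := by
    rw [← add_sub_cancel_left (Finsupp.linearCombination _ _ q) r, ← hqr]
    refine sub_mem hf ?_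
    rw [Finsupp.linearCombination_apply]
    exact sum_mem fun b _ => Ideal.mul_mem_left _ _ (hG b.2)
  rw [h r hrI hr, add_zero, Finsupp.linearCombination_apply] at hqr
  -- Division leaves remainder zero, so the leading monomial of `f` occurs in some summand `b * q
  -- b`. No summand has larger degree than `f`, so it is the leading monomial of that summand.
  have hc : coeff (m.degree f) f ≠ 0 := m.coeff_degree_ne_zero_iff.2 hf0
  nth_rw 2 [hqr] at hc
  rw [Finsupp.sum, coeff_sum] at hc
  obtain ⟨b, _, hb⟩ := Finset.exists_ne_zero_of_sum_ne_zero hc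
  rw [smul_eq_mul, mul_comm] at hb
  have hdeg' : m.degree f = m.degree ((b : MvPolynomial σ K) * q b) :=
    m.toSyn.injective (le_antisymm (m.le_degree (mem_support_iff.2 hb)) (hdeg b))
  have hb0 : (b : MvPolynomial σ K) * q b ≠ 0 := fun h => by simp [h] at hb
  rw [m.degree_mul (left_ne_zero_of_mul hb0) (right_ne_zero_of_mul hb0)] at hdeg'
  have hu : m.leadingCoeff (b : MvPolynomial σ K) ≠ 0 :=
    m.leadingCoeff_ne_zero_iff.2 (left_ne_zero_of_mul hb0)
  have : m.leadingTerm f = monomial (m.degree (q b)) (m.leadingCoeff f / m.leadingCoeff b.1) *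
      m.leadingTerm (b : MvPolynomial σ K) := by
    rw [MonomialOrder.leadingTerm, MonomialOrder.leadingTerm, monomial_mul, hdeg', add_comm,
      div_mul_cancel₀ _ hu]
  rw [SetLike.mem_coe, this]
  exact Ideal.mul_mem_left _ _ (Ideal.subset_span ⟨_, b.2, rfl⟩)

end Standard

/-! ### The quadratic Gröbner basis -/

section Presentation

variable {K R : Type*} [Field K] [CommRing R] [Algebra K R] {𝒜 : ℕ → Submodule K R}

/-- The exponent of the monomial `x_i * x_j`. -/
noncomputable abbrev pairExponent {σ : Type*} (i j : σ) : σ →₀ ℕ :=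
  Finsupp.single i 1 + Finsupp.single j 1

/-- The pairs of variables whose products are the leading monomials of the quadrics in the
Gröbner basis. -/
def LeadingPair (u : ℕ) (i j : ℕ) : Prop :=
  1 ≤ i ∧ 1 ≤ j ∧ (i = 1 → j < u) ∧ (j = 1 → i < u)

/-- Weights making `x_0` small and `x_1` smaller than the remaining variables. -/
def flagWeight (i : ℕ) : ℕ := if i = 0 then 0 else if i = 1 then 2 else 3

lemma flagWeight_le (i : ℕ) : flagWeight i ≤ 3 := by
  unfold flagWeight; split_ifs <;> omega

lemma weight_flagWeight_le {d : ℕ} (c : Fin d →₀ ℕ) :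
    Finsupp.weight (fun i : Fin d => flagWeight i) c ≤ 3 * c.degree := by
  rw [Finsupp.weight_eq_sum, Finsupp.degree_eq_sum, Finset.mul_sum]
  refine Finset.sum_le_sum fun i _ => ?_
  rw [smul_eq_mul, mul_comm 3]
  exact Nat.mul_le_mul_left _ (flagWeight_le i)

lemma two_le_flagWeight {i : ℕ} (h : 1 ≤ i) : 2 ≤ flagWeight i := by
  unfold flagWeight; split_ifs <;> omega

lemma flagWeight_of_two_le {i : ℕ} (h : 2 ≤ i) : flagWeight i = 3 := by
  unfold flagWeight; split_ifs <;> omega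

namespace AdaptedSequence

variable {d u : ℕ} {v : ℕ → R}

lemma map_aeval_homogeneousSubmodule (hgen : ∀ i, 𝒜 i = 𝒜 1 ^ i) (h : AdaptedSequence 𝒜 d u v)
    (k : ℕ) : (homogeneousSubmodule (Fin d) K k).map
      (aeval (R := K) fun i : Fin d => v i).toLinearMap = 𝒜 k := by
  rw [← homogeneousSubmodule_one_pow, Submodule.map_pow, homogeneousSubmodule_one_eq_span_X,
    Submodule.map_span, ← Set.range_comp, hgen, ← h.span_eq, initialSpan]
  congr
  ext i
  simp

lemma aeval_mem (hgen : ∀ i, 𝒜 i = 𝒜 1 ^ i) (h : AdaptedSequence 𝒜 d u v)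
    {k : ℕ} {f : MvPolynomial (Fin d) K} (hf : f.IsHomogeneous k) :
    aeval (fun i : Fin d => v i) f ∈ 𝒜 k := by
  rw [← h.map_aeval_homogeneousSubmodule hgen]
  exact Submodule.mem_map_of_mem hf

lemma exists_aeval_eq (hgen : ∀ i, 𝒜 i = 𝒜 1 ^ i) (h : AdaptedSequence 𝒜 d u v)
    {k : ℕ} {x : R} (hx : x ∈ 𝒜 k) :
    ∃ f : MvPolynomial (Fin d) K, f.IsHomogeneous k ∧ aeval (fun i : Fin d => v i) f = x := by
  rw [← h.map_aeval_homogeneousSubmodule hgen] at hx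
  exact hx

lemma eq_zero_of_isHomogeneous_one (h : AdaptedSequence 𝒜 d u v)
    {f : MvPolynomial (Fin d) K} (hf : f.IsHomogeneous 1)
    (h0 : aeval (fun i : Fin d => v i) f = 0) : f = 0 := by
  rw [← mem_homogeneousSubmodule, homogeneousSubmodule_one_eq_span_X,
    Submodule.mem_span_range_iff_exists_fun] at hf
  obtain ⟨c, rfl⟩ := hf
  have hc := Fintype.linearIndependent_iff.1 h.li c (by simpa using h0)
  simp [hc]

/-- A quadric in the kernel with prescribed leading monomial. -/
lemma exists_quadric (hgen : ∀ i, 𝒜 i = 𝒜 1 ^ i) (h : AdaptedSequence 𝒜 d u v)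
    (m : MonomialOrder (Fin d)) (hm : ∀ a b : Fin d →₀ ℕ,
      Finsupp.weight (fun i : Fin d => flagWeight i) a <
        Finsupp.weight (fun i : Fin d => flagWeight i) b → m.toSyn a < m.toSyn b)
    (i j : Fin d) (hij : LeadingPair u i j) :
    ∃ g : MvPolynomial (Fin d) K, g.IsHomogeneous 2 ∧ g ≠ 0 ∧
      aeval (fun i : Fin d => v i) g = 0 ∧ m.degree g = pairExponent i j := by
  classical
  have hd : 2 ≤ d := by have := hij.1; omega
  have h2 := h.two_le hd
  -- The quadric will be `x_i x_j - q`, every monomial of `q` having smaller weight than `x_i x_j`.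
  suffices ∃ q : MvPolynomial (Fin d) K, q.IsHomogeneous 2 ∧
      aeval (fun i : Fin d => v i) q = v i * v j ∧ ∀ c ∈ q.support,
      Finsupp.weight (fun i : Fin d => flagWeight i) c < flagWeight i + flagWeight j by
    obtain ⟨q, hq, hqv, hqc⟩ := this
    have hX : (X i * X j : MvPolynomial (Fin d) K) = monomial (pairExponent i j) 1 := by
      simp [X, monomial_mul]
    have hXd : m.degree (X i * X j : MvPolynomial (Fin d) K) = pairExponent i j := by
      rw [hX, m.degree_monomial, if_neg one_ne_zero]
    have hlt : m.toSyn (m.degree q) < m.toSyn (m.degree (X i * X j : MvPolynomial (Fin d) K)) := by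
      rw [hXd, m.degree_lt_iff]
      · intro c hc
        apply hm
        simpa [Finsupp.weight_single] using hqc c hc
      · rw [map_zero, m.toSyn_lt_iff_ne_zero, Ne, m.toSyn_eq_zero_iff]
        simp
    have hdeg : m.degree (X i * X j - q) = pairExponent i j := by
      rw [m.degree_sub_of_lt hlt, hXd]
    refine ⟨X i * X j - q, ((isHomogeneous_X K i).mul (isHomogeneous_X K j)).sub hq, ?_, ?_, hdeg⟩
    · intro h0
      rw [h0, m.degree_zero] at hdeg
      simpa using hdeg.symm
    · simp [hqv]
  have hX0 : ∀ (k : ℕ) (hk : k < d) (L : MvPolynomial (Fin d) K), L.IsHomogeneous 1 →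
      ∀ c ∈ (X (⟨k, hk⟩ : Fin d) * L).support,
        Finsupp.weight (fun i : Fin d => flagWeight i) c ≤ flagWeight k + 3 := by
    intro k hk L hL c hc
    rw [support_X_mul, Finset.mem_map] at hc
    obtain ⟨e, he, rfl⟩ := hc
    have h1 : e.degree = 1 := by
      rw [Finsupp.degree_eq_weight_one]
      exact hL (mem_support_iff.1 he)
    have h2 := weight_flagWeight_le e
    simp [Finsupp.weight_single]
    omega
  by_cases h1 : (i : ℕ) = 1 ∨ (j : ℕ) = 1
  · have : ∃ y ∈ 𝒜 1, v i * v j = v 0 * y := by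
      rcases h1 with hi | hj
      · rw [hi]
        exact (h.mem_iff hd _ (h.mem_one j.2)).1 (mem_initialSpan (hij.2.2.1 hi))
      · rw [hj, mul_comm]
        exact (h.mem_iff hd _ (h.mem_one i.2)).1 (mem_initialSpan (hij.2.2.2 hj))
    obtain ⟨y, hy, hxy⟩ := this
    obtain ⟨L, hL, rfl⟩ := h.exists_aeval_eq hgen hy
    refine ⟨X ⟨0, by omega⟩ * L, (isHomogeneous_X K _).mul hL, by simp [hxy], fun c hc => ?_⟩
    -- Multiples of `x_0` weigh at most `0 + 3`, whereas `x_i x_j` weighs at least `2 + 2`.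
    have h3 : Finsupp.weight (fun i : Fin d => flagWeight i) c ≤ 3 :=
      (hX0 0 (by omega) L hL c hc).trans (by simp [flagWeight])
    have := two_le_flagWeight hij.1
    have := two_le_flagWeight hij.2.1
    omega
  · obtain ⟨y, hy, z, hz, hxy⟩ := h.exists_eq hd (v i * v j) (by
      rw [hgen, pow_two]
      exact Submodule.mul_mem_mul (h.mem_one i.2) (h.mem_one j.2))
    obtain ⟨L, hL, rfl⟩ := h.exists_aeval_eq hgen hy
    obtain ⟨N, hN, rfl⟩ := h.exists_aeval_eq hgen hz
    refine ⟨X ⟨0, by omega⟩ * L + X ⟨1, by omega⟩ * N, ((isHomogeneous_X K _).mul hL).add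
      ((isHomogeneous_X K _).mul hN), by simp [hxy], fun c hc => ?_⟩
    -- Multiples of `x_1` weigh at most `2 + 3`, whereas `x_i x_j` with `i, j ≥ 2` weighs `3 + 3`.
    have h3 : Finsupp.weight (fun i : Fin d => flagWeight i) c ≤ 5 := by
      rcases Finset.mem_union.1 (support_add hc) with hc | hc
      · exact (hX0 0 (by omega) L hL c hc).trans (by simp [flagWeight])
      · exact (hX0 1 (by omega) N hN c hc).trans (by simp [flagWeight])
    rw [flagWeight_of_two_le (i := i) (by have := hij.1; omega),
      flagWeight_of_two_le (i := j) (by have := hij.2.1; omega)]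
    omega

/-- A monomial of degree at least two that is free of `x_0` and standard is `x_1 * x_j`. -/
lemma exists_eq_pairExponent (hd : 2 ≤ d) (hu : 2 ≤ u) {c : Fin d →₀ ℕ}
    (h0 : c ⟨0, by omega⟩ = 0) (hc : 2 ≤ c.degree)
    (hstd : ∀ i j : Fin d, LeadingPair u i j → ¬ pairExponent i j ≤ c) :
    ∃ j : Fin d, u ≤ j ∧ c = pairExponent ⟨1, hd⟩ j := by
  have split : ∀ e : Fin d →₀ ℕ, e ≠ 0 → ∃ (i : Fin d) (e' : Fin d →₀ ℕ),
      e = Finsupp.single i 1 + e' := by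
    intro e he
    obtain ⟨i, hi⟩ := Finsupp.ne_iff.1 he
    refine ⟨i, e - Finsupp.single i 1, (add_tsub_cancel_of_le ?_).symm⟩
    rw [Finsupp.single_le_iff]
    exact Nat.one_le_iff_ne_zero.2 hi
  obtain ⟨i, e, rfl⟩ := split c (by rintro rfl; simp at hc)
  obtain ⟨j, e, rfl⟩ := split e (by rintro rfl; simp at hc)
  have hne : ∀ k : Fin d, Finsupp.single k 1 ≤ Finsupp.single i 1 + (Finsupp.single j 1 + e) →
      1 ≤ (k : ℕ) := by
    intro k hk
    by_contra hk0
    have : k = ⟨0, by omega⟩ := Fin.ext (by simpa using hk0)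
    rw [Finsupp.single_le_iff, this, h0] at hk
    omega
  have hi := hne i le_self_add
  have hj := hne j (le_self_add.trans le_add_self)
  -- One of the two factors must be `x_1`, since `x_i x_j` with `i, j ≥ 2` is leading.
  wlog hi1 : (i : ℕ) = 1 generalizing i j
  · have hj1 : (j : ℕ) = 1 := by
      by_contra hj1
      exact hstd i j ⟨hi, hj, by omega, by omega⟩ (by rw [← add_assoc]; exact le_self_add)
    rw [add_left_comm] at h0 hc hstd hne ⊢
    exact this j i h0 hc hstd hne hj hi hj1
  obtain rfl : i = ⟨1, hd⟩ := Fin.ext hi1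
  have hju : u ≤ j := by
    by_contra hlt
    exact hstd ⟨1, hd⟩ j ⟨le_rfl, hj, fun _ => by omega, fun _ => Nat.lt_of_succ_le hu⟩
      (by rw [← add_assoc]; exact le_self_add)
  refine ⟨j, hju, ?_⟩
  by_cases he : e = 0
  · simp [he]
  obtain ⟨k, e, rfl⟩ := split e he
  have hk := hne k (le_self_add.trans (le_add_self.trans le_add_self))
  -- A third factor `x_k` is impossible: `x_1 x_k` is leading if `k = 1`, and `x_j x_k` is leading
  -- if `k ≥ 2`, as `j ≥ u ≥ 2`.
  exfalso
  by_cases hku : (k : ℕ) = 1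
  · refine hstd ⟨1, hd⟩ k ⟨le_rfl, hk, fun _ => by omega, fun _ => Nat.lt_of_succ_le hu⟩ ?_
    rw [add_left_comm (Finsupp.single j 1), ← add_assoc]
    exact le_self_add
  · refine hstd j k ⟨hj, hk, by omega, by omega⟩ ?_
    rw [← add_assoc (Finsupp.single j 1)]
    exact le_add_self.trans' le_self_add

/-- A form that is a combination of standard monomials is not in the kernel. -/
lemma eq_zero_of_standard [Nontrivial R] (hgen : ∀ i, 𝒜 i = 𝒜 1 ^ i)
    (h : AdaptedSequence 𝒜 d u v) (D : ℕ) {r : MvPolynomial (Fin d) K} (hr : r.IsHomogeneous D)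
    (hstd : ∀ c ∈ r.support, ∀ i j : Fin d, LeadingPair u i j → ¬ pairExponent i j ≤ c)
    (h0 : aeval (fun i : Fin d => v i) r = 0) : r = 0 := by
  induction D using Nat.strong_induction_on generalizing r with
  | _ D ih =>
  match D, ih, hr with
  | 0, _, hr =>
    have hC := totalDegree_eq_zero_iff_eq_C.1 ((totalDegree_zero_iff_isHomogeneous _).2 hr)
    rw [hC, aeval_C, map_eq_zero] at h0
    rw [hC, h0, C_0]
  | 1, _, hr => exact h.eq_zero_of_isHomogeneous_one hr h0
  | D + 2, ih, hr =>
    have hd0 : 0 < d := h.one_le.trans h.le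
    set q := divMonomial r (Finsupp.single (⟨0, hd0⟩ : Fin d) 1) with hq
    set s := modMonomial r (Finsupp.single (⟨0, hd0⟩ : Fin d) 1) with hs
    have hrqs : X ⟨0, hd0⟩ * q + s = r := divMonomial_add_modMonomial_single _ _
    have hdiv : ∀ (e : ℕ) (i : Fin d) (f : MvPolynomial (Fin d) K), f.IsHomogeneous (e + 1) →
        (divMonomial f (Finsupp.single i 1)).IsHomogeneous e := by
      intro e i f hf c hc
      rw [coeff_divMonomial] at hc
      have := hf hc
      rw [map_add, Finsupp.weight_single, Pi.one_apply, smul_eq_mul] at this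
      omega
    have hqh : q.IsHomogeneous (D + 1) := hdiv _ _ _ hr
    have hqstd : ∀ c ∈ q.support, ∀ i j : Fin d, LeadingPair u i j →
        ¬ pairExponent i j ≤ c := by
      intro c hc i j hij hle
      rw [mem_support_iff, coeff_divMonomial] at hc
      exact hstd _ (mem_support_iff.2 hc) i j hij (hle.trans le_add_self)
    have hsc : ∀ c ∈ s.support, c ⟨0, hd0⟩ = 0 ∧ c ∈ r.support := by
      intro c hc
      rw [mem_support_iff] at hc
      by_cases hle : Finsupp.single (⟨0, hd0⟩ : Fin d) 1 ≤ c
      · exact absurd (coeff_modMonomial_of_le r hle) hc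
      · rw [hs, coeff_modMonomial_of_not_le r hle, ← mem_support_iff] at hc
        rw [Finsupp.single_le_iff] at hle
        exact ⟨by omega, hc⟩
    have hval : v 0 * aeval (fun i : Fin d => v i) q + aeval (fun i : Fin d => v i) s = 0 := by
      rw [← h0, ← hrqs]
      simp
    -- Write `r = x_0 q + s` with `s` free of `x_0`. Once `s = 0`, regularity of `v 0` puts `q` in
    -- the kernel, and induction on the degree applies.
    suffices hs0 : s = 0 by
      rw [hs0, map_zero, add_zero] at hval
      rw [← hrqs, hs0, ih (D + 1) (by omega) hqh hqstd (h.regular _ hval)]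
      simp
    by_cases hd : 2 ≤ d
    swap
    · by_contra hs0
      obtain ⟨c, hc⟩ := ne_zero_iff.1 hs0
      obtain ⟨hc0, hcr⟩ := hsc c (mem_support_iff.2 hc)
      have : c = 0 := by
        ext i
        obtain rfl : i = ⟨0, hd0⟩ := Fin.ext (by simp; omega)
        exact hc0
      have := hr (mem_support_iff.1 hcr)
      simp_all
    have hu := h.two_le hd
    have hpair : ∀ c ∈ s.support, ∃ j : Fin d, u ≤ j ∧ c = pairExponent ⟨1, hd⟩ j := by
      intro c hc
      obtain ⟨hc0, hcr⟩ := hsc c hc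
      refine exists_eq_pairExponent hd hu hc0 ?_ (hstd c hcr)
      have := hr (mem_support_iff.1 hcr)
      rw [Finsupp.degree_eq_weight_one]
      exact this.symm ▸ Nat.le_add_left _ _
    by_contra hs0
    -- The only standard monomials free of `x_0` in degree at least 2 are `x_1 x_j` with `j ≥ u`,
    -- all quadratic.
    have hD : D = 0 := by
      obtain ⟨c, hc⟩ := ne_zero_iff.1 hs0
      obtain ⟨j, _, rfl⟩ := hpair c (mem_support_iff.2 hc)
      have := hr (mem_support_iff.1 (hsc _ (mem_support_iff.2 hc)).2)
      simp [Finsupp.weight_single] at this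
      omega
    subst hD
    have hsh : s.IsHomogeneous 2 := fun c hc =>
      hr (mem_support_iff.1 (hsc c (mem_support_iff.2 hc)).2)
    set t := divMonomial s (Finsupp.single (⟨1, hd⟩ : Fin d) 1) with ht
    have hst : X ⟨1, hd⟩ * t = s := by
      conv_rhs => rw [← divMonomial_add_modMonomial_single s ⟨1, hd⟩]
      rw [left_eq_add]
      ext c
      by_cases hle : Finsupp.single (⟨1, hd⟩ : Fin d) 1 ≤ c
      · rw [coeff_modMonomial_of_le s hle, coeff_zero]
      · rw [coeff_modMonomial_of_not_le s hle, coeff_zero]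
        by_contra hc
        obtain ⟨j, _, rfl⟩ := hpair c (mem_support_iff.2 hc)
        exact hle le_self_add
    have hth : t.IsHomogeneous 1 := hdiv _ _ _ hsh
    have htc : ∀ j : Fin d, (j : ℕ) < u → coeff (Finsupp.single j 1) t = 0 := by
      intro j hj
      by_contra hne
      rw [ht, coeff_divMonomial] at hne
      obtain ⟨k, hk, hkj⟩ := hpair _ (mem_support_iff.2 hne)
      have := Finsupp.single_left_injective one_ne_zero (add_left_cancel hkj)
      omega
    rw [← hst] at hval
    -- With `s = x_1 t`, the relation reads `v_1 t = -v_0 q`, so `t` lies in `U`, spanned by the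
    -- `v_j` with `j < u`. But `t` involves only `x_j` with `j ≥ u`, so independence forces `t = 0`.
    have hmem : aeval (fun i : Fin d => v i) t ∈ initialSpan K v u := by
      rw [h.mem_iff hd _ (h.aeval_mem hgen hth)]
      refine ⟨_, neg_mem (h.aeval_mem hgen hqh), ?_⟩
      rw [map_mul, aeval_X] at hval
      linear_combination hval
    rw [initialSpan, Submodule.mem_span_range_iff_exists_fun] at hmem
    obtain ⟨a, ha⟩ := hmem
    have hta : t - ∑ i, C (a i) * X (Fin.castLE h.le i) = 0 := by
      refine h.eq_zero_of_isHomogeneous_one (hth.sub (IsHomogeneous.sum _ _ _ fun i _ => ?_)) ?_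
      · exact isHomogeneous_C_mul_X _ _
      · rw [map_sub, ← ha, map_sum, sub_eq_zero]
        simp [Algebra.smul_def]
    have ha0 : ∀ i, a i = 0 := by
      intro i
      have hi := htc (Fin.castLE h.le i) i.2
      rw [sub_eq_zero.1 hta, coeff_sum, Finset.sum_eq_single i] at hi
      · simpa using hi
      · intro j _ hj
        rw [coeff_C_mul, coeff_X, if_neg, mul_zero]
        intro he
        exact hj (Fin.castLE_injective _ (Finsupp.single_left_injective one_ne_zero he))
      · simp
    apply hs0
    rw [← hst, sub_eq_zero.1 hta]
    simp [ha0]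

theorem isGQuadratic [Nontrivial R] [GradedAlgebra 𝒜] (hgen : ∀ i, 𝒜 i = 𝒜 1 ^ i)
    (h : AdaptedSequence 𝒜 d u v) : IsGQuadratic 𝒜 := by
  classical
  have hbasis : ∃ b : Module.Basis (Fin d) K (initialSpan K v d), ∀ i, (b i : R) = v i :=
    ⟨Module.Basis.span h.li, fun i => congrArg Subtype.val (Module.Basis.span_apply h.li i)⟩
  rw [h.span_eq] at hbasis
  obtain ⟨b, hb⟩ := hbasis
  replace hb : (fun i => (b i : R)) = fun i : Fin d => v i := funext hb
  obtain ⟨m, hm⟩ := exists_monomialOrder_of_weight fun i : Fin d => flagWeight i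
  refine ⟨d, b, ?_, m, ?_⟩
  · rw [hb]
    intro x
    rw [← AlgHom.mem_range, ← DirectSum.sum_support_decompose 𝒜 x]
    refine sum_mem fun i _ => ?_
    obtain ⟨f, _, hf⟩ := h.exists_aeval_eq hgen (DirectSum.decompose 𝒜 x i).2
    exact ⟨f, hf⟩
  rw [hb]
  choose! g hg using fun p : Fin d × Fin d => h.exists_quadric hgen m hm p.1 p.2
  refine ⟨(Finset.univ.filter fun p : Fin d × Fin d => LeadingPair u p.1 p.2).image g, ?_, ?_⟩
  swap
  · simp only [Finset.mem_image, Finset.mem_filter, Finset.mem_univ, true_and]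
    rintro _ ⟨p, hp, rfl⟩
    exact (hg p hp).1
  apply isGroebnerBasis_of_standard
  · intro f hf
    simp only [Finset.coe_image, Finset.coe_filter, Finset.mem_univ, true_and] at hf
    obtain ⟨p, hp, rfl⟩ := hf
    exact (hg p hp).2.2.1
  · simp only [Finset.mem_image, Finset.mem_filter, Finset.mem_univ, true_and]
    rintro ⟨p, hp, hp0⟩
    exact (hg p hp).2.1 hp0
  · intro r hr hstd
    -- The kernel is homogeneous and components inherit standardness, so it suffices to treat forms.
    rw [← sum_homogeneousComponent r]
    refine Finset.sum_eq_zero fun D _ => ?_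
    refine h.eq_zero_of_standard hgen D (homogeneousComponent_isHomogeneous _ _) ?_ ?_
    · intro c hc i j hij
      rw [mem_support_iff, coeff_homogeneousComponent] at hc
      rw [← (hg (i, j) hij).2.2.2]
      exact hstd c (mem_support_iff.2 fun h0 => hc (by simp [h0])) _
        (Finset.mem_image_of_mem g (by simpa using hij))
    · have hD : ∀ N, (DirectSum.decompose 𝒜 (aeval (fun i : Fin d => v i) r) N : R) =
          aeval (fun i : Fin d => v i) (homogeneousComponent N r) := by
        intro N
        conv_lhs => rw [← sum_homogeneousComponent r]
        rw [map_sum, DirectSum.decompose_sum, DFinsupp.finsetSum_apply,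
          AddSubmonoidClass.coe_finsetSum, Finset.sum_eq_single N]
        · exact DirectSum.decompose_of_mem_same 𝒜
            (h.aeval_mem hgen (homogeneousComponent_isHomogeneous _ _))
        · intro M _ hM
          exact DirectSum.decompose_of_mem_ne 𝒜
            (h.aeval_mem hgen (homogeneousComponent_isHomogeneous _ _)) hM
        · intro hN
          rw [homogeneousComponent_eq_zero _ _ (by simpa [Nat.lt_succ_iff] using hN)]
          simp
      rw [← hD, RingHom.mem_ker.1 hr]
      simp

end AdaptedSequence

end Presentation

/-! ### Coordinate rings of points in general position -/

section Points

variable {K : Type*} [Field K] {n : ℕ}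

lemma _root_.MvPolynomial.IsHomogeneous.eval_smul {σ : Type*} {f : MvPolynomial σ K} {d : ℕ}
    (hf : f.IsHomogeneous d) (a : K) (w : σ → K) : eval (a • w) f = a ^ d * eval w f := by
  rw [eval_eq, eval_eq, Finset.mul_sum]
  refine Finset.sum_congr rfl fun c hc => ?_
  have hd : ∑ i ∈ c.support, c i = d := by
    rw [← hf (mem_support_iff.1 hc)]
    exact DFunLike.congr_fun (Finsupp.degree_eq_weight_one (R := ℕ)) c
  simp only [Pi.smul_apply, smul_eq_mul, mul_pow, Finset.prod_mul_distrib]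
  rw [Finset.prod_pow_eq_pow_sum, hd, mul_left_comm]

variable {R : Type*} [CommRing R] [Algebra K R]

/-- The grading of a quotient `R` of the polynomial ring by the images of the forms. -/
noncomputable def imageGrading (π : MvPolynomial (Fin (n + 1)) K →ₐ[K] R) (d : ℕ) :
    Submodule K R :=
  (homogeneousSubmodule (Fin (n + 1)) K d).map π.toLinearMap

variable (X : Finset (Projectivization K (Fin (n + 1) → K)))

/-- The projection `π` presents `R` as the homogeneous coordinate ring of `X`, with evaluation
`ev p` at the chosen representative of `p`. -/
structure IsCoordinateProjection (π : MvPolynomial (Fin (n + 1)) K →ₐ[K] R)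
    (ev : X → R →ₐ[K] K) : Prop where
  surjective : Function.Surjective π
  homogeneousComponent : ∀ f, π f = 0 → ∀ i, π (homogeneousComponent i f) = 0
  ev_apply : ∀ p f, ev p (π f) = eval p.1.rep f
  eq_zero : ∀ d f, IsHomogeneous f d → (∀ p : X, eval p.1.rep f = 0) → π f = 0

lemma eval_rep_eq_zero (p : X) {f : MvPolynomial (Fin (n + 1)) K} (hf : f ∈ vanishingIdeal X) :
    eval p.1.rep f = 0 := by
  have : vanishingIdeal X ≤ RingHom.ker (eval p.1.rep) := by
    refine Ideal.span_le.2 fun g hg => ?_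
    exact hg.2 _ p.1.rep_nonzero (by rw [p.1.mk_rep]; exact p.2)
  exact this hf

/-- Evaluation of elements of the coordinate ring at the chosen representative of a point. -/
noncomputable def pointEval (p : X) : CoordinateRing X →ₐ[K] K :=
  Ideal.Quotient.liftₐ (vanishingIdeal X) (aeval p.1.rep) fun f hf => by
    rw [aeval_eq_eval]
    exact eval_rep_eq_zero X p hf

lemma isCoordinateProjection_mk :
    IsCoordinateProjection X (Ideal.Quotient.mkₐ K (vanishingIdeal X)) (pointEval X) where
  surjective := Ideal.Quotient.mkₐ_surjective K _
  homogeneousComponent f hf i := by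
    let : GradedAlgebra (homogeneousSubmodule (Fin (n + 1)) K) := gradedAlgebra
    have h : (vanishingIdeal X).IsHomogeneous (homogeneousSubmodule (Fin (n + 1)) K) :=
      Ideal.homogeneous_span _ _ fun g hg => hg.1
    have h1 := h i (Ideal.Quotient.eq_zero_iff_mem.1 hf)
    exact Ideal.Quotient.eq_zero_iff_mem.2 (by
      rwa [← decomposition.decompose'_apply])
  ev_apply p f := by
    rw [← aeval_eq_eval]
    rfl
  eq_zero d f hf h := by
    refine Ideal.Quotient.eq_zero_iff_mem.2 (Ideal.subset_span ⟨⟨d, hf⟩, fun v hv hvX => ?_⟩)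
    -- Rescaling multiplies the value of a form by a power of a unit, so vanishing at the chosen
    -- representative suffices.
    obtain ⟨a, ha⟩ := Projectivization.exists_smul_eq_mk_rep K v hv
    have h0 := h ⟨_, hvX⟩
    rw [← ha, Units.smul_def, IsHomogeneous.eval_smul hf] at h0
    exact (mul_eq_zero.1 h0).resolve_left (pow_ne_zero _ a.ne_zero)

variable {X}

lemma imageGrading_eq_pow (π : MvPolynomial (Fin (n + 1)) K →ₐ[K] R) (i : ℕ) :
    imageGrading π i = imageGrading π 1 ^ i := by
  rw [imageGrading, imageGrading, ← Submodule.map_pow, homogeneousSubmodule_one_pow]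

lemma mul_mem_imageGrading {π : MvPolynomial (Fin (n + 1)) K →ₐ[K] R} {i j : ℕ} {x y : R}
    (hx : x ∈ imageGrading π i) (hy : y ∈ imageGrading π j) :
    x * y ∈ imageGrading π (i + j) := by
  rw [imageGrading_eq_pow] at *
  rw [pow_add]
  exact Submodule.mul_mem_mul hx hy

instance (π : MvPolynomial (Fin (n + 1)) K →ₐ[K] R) : SetLike.GradedMonoid (imageGrading π) where
  one_mem := by
    rw [imageGrading_eq_pow, pow_zero]
    exact Submodule.one_le.1 le_rfl
  mul_mem _ _ _ _ := mul_mem_imageGrading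

instance (π : MvPolynomial (Fin (n + 1)) K →ₐ[K] R) : Module.Finite K (imageGrading π 1) := by
  rw [Module.Finite.iff_fg]
  exact (homogeneousSubmodule_fg (Fin (n + 1)) K 1).map _

/-- Representatives of at most `n + 1` points are independent, so a functional can be prescribed on
them and extended. -/
lemma exists_dual_eq (hpos : InGeneralLinearPosition X) {Y : Finset X} (hY : Y.card ≤ n + 1)
    (c : X → K) : ∃ φ : Module.Dual K (Fin (n + 1) → K), ∀ p ∈ Y, φ p.1.rep = c p := by
  classical
  let e : Y → Y.map (Function.Embedding.subtype _) :=
    fun p => ⟨p.1.1, Finset.mem_map_of_mem (Function.Embedding.subtype _) p.2⟩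
  have he : Function.Injective e := fun p q hpq =>
    Subtype.ext (Subtype.ext (Subtype.mk.inj hpq))
  have hli : LinearIndependent K (fun p : Y => p.1.1.rep) :=
    (Projectivization.independent_iff.1 (hpos (Y.map (Function.Embedding.subtype _))
      (fun p hp => by
        obtain ⟨q, _, rfl⟩ := Finset.mem_map.1 hp
        exact q.2) (by rwa [Finset.card_map]))).comp e he
  obtain ⟨φ, hφ⟩ := LinearMap.exists_extend
    (Finsupp.linearCombination K (fun p : Y => c p.1) ∘ₗ hli.repr)
  refine ⟨φ, fun p hp => ?_⟩
  have h := LinearMap.congr_fun hφ (⟨p.1.rep, Submodule.subset_span ⟨⟨p, hp⟩, rfl⟩⟩ :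
    Submodule.span K (Set.range fun p : Y => p.1.1.rep))
  rw [LinearMap.comp_apply, Submodule.subtype_apply, LinearMap.comp_apply,
    hli.repr_eq_single ⟨p, hp⟩ _ rfl] at h
  simpa using h

namespace IsCoordinateProjection

variable {π : MvPolynomial (Fin (n + 1)) K →ₐ[K] R} {ev : X → R →ₐ[K] K}

/-- Homogeneous elements of the coordinate ring are determined by their values. -/
lemma eq_of_ev_eq (h : IsCoordinateProjection X π ev) {d : ℕ} {x y : R}
    (hx : x ∈ imageGrading π d) (hy : y ∈ imageGrading π d) (hxy : ∀ p, ev p x = ev p y) :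
    x = y := by
  rw [← sub_eq_zero]
  obtain ⟨f, hf, hfx⟩ := sub_mem hx hy
  rw [← hfx]
  refine h.eq_zero d f hf fun p => ?_
  rw [← h.ev_apply, ← AlgHom.toLinearMap_apply π, hfx, map_sub, hxy, sub_self]

/-- Directness of the sum is the homogeneity of the kernel of `π`. -/
lemma isInternal (h : IsCoordinateProjection X π ev) : DirectSum.IsInternal (imageGrading π) := by
  classical
  constructor
  · rw [injective_iff_map_eq_zero]
    intro x hx
    choose f hf hfx using fun i => (x i).2
    rw [DirectSum.coeAddMonoidHom_eq_dfinsuppSum, DFinsupp.sum] at hx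
    have hmem : π (∑ i ∈ DFinsupp.support x, f i) = 0 := by
      rw [map_sum, ← hx]
      exact Finset.sum_congr rfl fun i _ => hfx i
    ext i
    by_cases hi : i ∈ DFinsupp.support x
    · have := h.homogeneousComponent _ hmem i
      rw [map_sum, Finset.sum_eq_single i, homogeneousComponent_of_mem (hf i), if_pos rfl] at this
      · rw [← hfx i]
        exact this
      · intro j _ hj
        rw [homogeneousComponent_of_mem (hf j), if_neg hj.symm]
      · exact fun h => absurd hi h
    · rw [DFinsupp.notMem_support_iff.1 hi]
      rfl
  · intro x
    obtain ⟨f, rfl⟩ := h.surjective x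
    rw [← sum_homogeneousComponent f, map_sum]
    refine ⟨∑ i ∈ Finset.range (f.totalDegree + 1), DirectSum.of (fun i => imageGrading π i) i
      ⟨_, Submodule.mem_map_of_mem (homogeneousComponent_mem i f)⟩, ?_⟩
    rw [map_sum]
    refine Finset.sum_congr rfl fun i _ => ?_
    rw [DirectSum.coeAddMonoidHom_of]
    rfl

/-- A linear form that vanishes at no point is a nonzerodivisor. -/
lemma eq_zero_of_mul_eq_zero (h : IsCoordinateProjection X π ev) {l : R}
    (hl : l ∈ imageGrading π 1) (hne : ∀ p, ev p l ≠ 0) (x : R) (hx : l * x = 0) : x = 0 := by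
  let := h.isInternal.gradedAlgebra
  -- Only homogeneous elements are determined by their values, hence the passage to components.
  refine (Ideal.mem_bot).1 (mem_of_forall_decompose_mem (𝒜 := imageGrading π) fun i => ?_)
  refine (Ideal.mem_bot).2 (h.eq_of_ev_eq (SetLike.coe_mem _) (zero_mem _) fun p => ?_)
  have h0 := decompose_succ_mul (x := x) hl i
  rw [mul_comm x, hx] at h0
  have h1 := congrArg (ev p) h0
  rw [map_mul] at h1
  simpa [hne p] using h1.symm

lemma nontrivial (_ : IsCoordinateProjection X π ev) (hne : X.Nonempty) : Nontrivial R := by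
  obtain ⟨p, hp⟩ := hne
  exact (ev ⟨p, hp⟩).toRingHom.domain_nontrivial

/-- The linear form attached to a linear functional. -/
lemma exists_linearForm (h : IsCoordinateProjection X π ev) (φ : Module.Dual K (Fin (n + 1) → K)) :
    ∃ x ∈ imageGrading π 1, ∀ p : X, ev p x = φ p.1.rep := by
  classical
  refine ⟨π (∑ i, C (φ (Pi.single i 1)) * MvPolynomial.X i), Submodule.mem_map_of_mem
    (IsHomogeneous.sum _ _ _ fun i _ => isHomogeneous_C_mul_X _ _), fun p => ?_⟩
  · rw [h.ev_apply]
    conv_rhs => rw [pi_eq_sum_univ' p.1.rep]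
    simp [mul_comm]

lemma exists_linearForm_eq (h : IsCoordinateProjection X π ev) 
    (hpos : InGeneralLinearPosition X) {Y : Finset X}
    (hY : Y.card ≤ n + 1) (c : X → K) :
    ∃ x ∈ imageGrading π 1, ∀ p ∈ Y, ev p x = c p := by
  obtain ⟨φ, hφ⟩ := exists_dual_eq hpos hY c
  obtain ⟨x, hx, hxφ⟩ := h.exists_linearForm φ
  exact ⟨x, hx, fun p hp => (hxφ p).trans (hφ p hp)⟩

/-- Any set of at most `n` of the points is the zero set in `X` of a linear form. -/
lemma exists_linearForm_eq_zero_iff [Infinite K] (h : IsCoordinateProjection X π ev) 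
    (hpos : InGeneralLinearPosition X)
    {Y : Finset X} (hY : Y.card ≤ n) :
    ∃ x ∈ imageGrading π 1, ∀ p, ev p x = 0 ↔ p ∈ Y := by
  classical
  -- Over an infinite field, the functionals vanishing on `Y` are not covered by the finitely many
  -- proper subspaces of those that also vanish at some further point `q`. Each subspace is proper
  -- because `Y` and `q` together have at most `n + 1` points.
  obtain ⟨φ, hφY, hφ⟩ := Module.Dual.exists_forall_mem_ne_zero_of_forall_exists
    (⨅ p ∈ Y, LinearMap.ker (Module.Dual.eval K (Fin (n + 1) → K) p.1.rep))
    (fun q : {q // q ∉ Y} => Module.Dual.eval K (Fin (n + 1) → K) q.1.1.rep) (fun q => by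
      obtain ⟨φ, hφ⟩ := exists_dual_eq hpos (Y := insert q.1 Y)
        ((Finset.card_insert_le _ _).trans (Nat.succ_le_succ hY)) fun p => if p ∈ Y then 0 else 1
      refine ⟨φ, ?_, ?_⟩
      · simp only [Submodule.mem_iInf, LinearMap.mem_ker, Module.Dual.eval_apply]
        intro p hp
        rw [hφ p (Finset.mem_insert_of_mem hp), if_pos hp]
      · rw [Module.Dual.eval_apply, hφ q (Finset.mem_insert_self _ _), if_neg q.2]
        exact one_ne_zero)
  simp only [Submodule.mem_iInf, LinearMap.mem_ker, Module.Dual.eval_apply] at hφY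
  obtain ⟨x, hx, hxφ⟩ := h.exists_linearForm φ
  refine ⟨x, hx, fun p => ⟨fun h0 => ?_, fun hp => (hxφ p).trans (hφY p hp)⟩⟩
  by_contra hp
  exact hφ ⟨p, hp⟩ ((hxφ p).symm.trans h0)

theorem exists_adaptedSequence [Infinite K] (h : IsCoordinateProjection X π ev) 
    (hne : X.Nonempty)
    (hcard : X.card ≤ 2 * n) (hpos : InGeneralLinearPosition X) :
    ∃ d u v, AdaptedSequence (imageGrading π) d u v := by
  classical
  have := h.nontrivial hne
  have hX : (Finset.univ : Finset X).card = X.card := by simp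
  by_cases hone : X.card ≤ 1
  · obtain ⟨l, hl, hl0⟩ := h.exists_linearForm_eq_zero_iff hpos (Y := ∅) (Nat.zero_le n)
    have hl0' : ∀ p, ev p l ≠ 0 := fun p h0 => by simpa using (hl0 p).1 h0
    obtain ⟨p, hp⟩ := hne
    obtain ⟨v, hv⟩ := exists_adaptedSequence_of_le_span hl (h.eq_zero_of_mul_eq_zero hl hl0')
      fun x hx => by
        refine Submodule.mem_span_singleton.2
          ⟨ev ⟨p, hp⟩ x / ev ⟨p, hp⟩ l, h.eq_of_ev_eq
            (Submodule.smul_mem _ _ hl) hx fun q => ?_⟩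
        obtain rfl : q = ⟨p, hp⟩ := Subtype.ext (Finset.card_le_one.1 hone _ q.2 _ hp)
        rw [map_smul, smul_eq_mul, div_mul_cancel₀ _ (hl0' _)]
    exact ⟨1, 1, v, hv⟩
  -- Both halves are nonempty since `s ≥ 2`, and have at most `n` points since `s ≤ 2n`.
  obtain ⟨A, _, hA⟩ := Finset.exists_subset_card_eq
    (show X.card / 2 ≤ (Finset.univ : Finset X).card by omega)
  have hAB : A.card + Aᶜ.card = X.card := by rw [Finset.card_add_card_compl]; simp
  obtain ⟨m, hm, hm0⟩ := h.exists_linearForm_eq_zero_iff hpos (Y := Aᶜ) (by omega)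
  obtain ⟨m', hm', hm'0⟩ := h.exists_linearForm_eq_zero_iff hpos (Y := A) (by omega)
  simp only [Finset.mem_compl] at hm0
  obtain ⟨a, ha⟩ : A.Nonempty := Finset.card_pos.1 (by omega)
  obtain ⟨b, hb⟩ : Aᶜ.Nonempty := Finset.card_pos.1 (by omega)
  rw [Finset.mem_compl] at hb
  have hl : m + m' ∈ imageGrading π 1 := add_mem hm hm'
  have hlA : ∀ p ∈ A, ev p (m + m') = ev p m := fun p hp => by
    rw [map_add, (hm'0 p).2 hp, add_zero]
  have hlB : ∀ p ∉ A, ev p (m + m') = ev p m' := fun p hp => by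
    rw [map_add, (hm0 p).2 hp, zero_add]
  refine PointsGroebner.exists_adaptedSequence hl hm ?_ (h.eq_zero_of_mul_eq_zero hl fun p => ?_) ?_ ?_
  · rw [LinearIndependent.pair_iff]
    intro s t hst
    have hsb := congrArg (ev b) hst
    rw [map_add, map_smul, map_smul, hlB b hb, (hm0 b).2 hb, smul_zero, add_zero, map_zero,
      smul_eq_mul] at hsb
    have hs : s = 0 := (mul_eq_zero.1 hsb).resolve_right fun h0 => hb ((hm'0 b).1 h0)
    have hta := congrArg (ev a) hst
    rw [hs, zero_smul, zero_add, map_smul, map_zero, smul_eq_mul] at hta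
    exact ⟨hs, (mul_eq_zero.1 hta).resolve_right fun h0 => (hm0 a).1 h0 ha⟩
  · by_cases hp : p ∈ A
    · rw [hlA p hp]
      exact fun h0 => (hm0 p).1 h0 hp
    · rw [hlB p hp]
      exact fun h0 => hp ((hm'0 p).1 h0)
  -- `m² = l m` holds pointwise: `l = m` on `A`, and `m = 0` off `A`.
  · refine ⟨m, hm, h.eq_of_ev_eq (mul_mem_imageGrading hm hm)
      (mul_mem_imageGrading hl hm) fun p => ?_⟩
    rw [map_mul, map_mul]
    by_cases hp : p ∈ A
    · rw [hlA p hp]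
    · rw [(hm0 p).2 hp, mul_zero, mul_zero]
  · intro x hx
    obtain ⟨y, hy, hyx⟩ := h.exists_linearForm_eq hpos (Y := Aᶜ) (by omega)
      fun p => ev p x / ev p m'
    obtain ⟨z, hz, hzx⟩ := h.exists_linearForm_eq hpos (Y := A) (by omega)
      fun p => ev p x / ev p m
    -- On `A`, `l y + m (z - y) = m z = x`; off `A`, it equals `m' y = x`.
    refine ⟨y, hy, z - y, sub_mem hz hy, h.eq_of_ev_eq hx (add_mem
      (mul_mem_imageGrading hl hy) (mul_mem_imageGrading hm (sub_mem hz hy)))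
      fun p => ?_⟩
    rw [map_add, map_mul, map_mul, map_sub]
    by_cases hp : p ∈ A
    · rw [hlA p hp, hzx p hp, ← mul_add, add_sub_cancel, mul_div_cancel₀]
      exact fun h0 => (hm0 p).1 h0 hp
    · rw [hlB p hp, (hm0 p).2 hp, zero_mul, add_zero, hyx p (Finset.mem_compl.2 hp),
        mul_div_cancel₀]
      exact fun h0 => hp ((hm'0 p).1 h0)

theorem hasGroebnerFlag [Infinite K] (h : IsCoordinateProjection X π ev)
    (hne : X.Nonempty) (hcard : X.card ≤ 2 * n) (hpos : InGeneralLinearPosition X) :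
    HasGroebnerFlag (imageGrading π) := by
  let := h.isInternal.gradedAlgebra
  obtain ⟨d, u, v, hv⟩ := h.exists_adaptedSequence hne hcard hpos
  exact hv.hasGroebnerFlag (imageGrading_eq_pow π)

theorem isGQuadratic [Infinite K] (h : IsCoordinateProjection X π ev)
    (hne : X.Nonempty) (hcard : X.card ≤ 2 * n) (hpos : InGeneralLinearPosition X) :
    IsGQuadratic (imageGrading π) := by
  have := h.nontrivial hne
  let := h.isInternal.gradedAlgebra
  obtain ⟨d, u, v, hv⟩ := h.exists_adaptedSequence hne hcard hpos
  exact hv.isGQuadratic (imageGrading_eq_pow π)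

end IsCoordinateProjection

end Points

end PointsGroebner

theorem mainTheorem2 {K : Type*} [Field K] [Infinite K] (n : ℕ)
    (X : Finset (Projectivization K (Fin (n + 1) → K)))
    (hne : X.Nonempty) (hcard : X.card ≤ 2 * n)
    (hpos : PointsGroebner.InGeneralLinearPosition X) :
    PointsGroebner.HasGroebnerFlag (PointsGroebner.coordinateGrading X) ∧
      PointsGroebner.IsGQuadratic (PointsGroebner.coordinateGrading X) := by
  have h := PointsGroebner.isCoordinateProjection_mk X
  exact ⟨h.hasGroebnerFlag hne hcard hpos, h.isGQuadratic hne hcard hpos⟩
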